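/- Let $M$ be a connected smooth ($C^\infty$) finite-dimensional manifold without boundary and let $g$ be a smooth pseudo-Riemannian metric on $M$ (a smooth field of nondegenerate symmetric bilinear forms on the tangent spaces). Let $\pi\colon TM\to M$ be the projection and let $K\colon TTM\to TM$ be the connection map of the Levi-Civita connection of $g$; in the coordinates $(x,v)$ on $TM$ induced by a chart of $M$ it is $K(\dot x,\dot v)=\dot v+\Gamma_x(v,\dot x)$, where $\Gamma$ denotes the Christoffel symbols. Then there is a smooth pseudo-Riemannian metric $\overline g$ on $TM$ that is the Sasaki metric of $g$, i.e. $$\overline g_v(\xi,\eta)=g_{\pi(v)}(d\pi_v\xi,d\pi_v\eta)+g_{\pi(v)}(K\xi,K\eta)\qquad(v\in TM,\ \xi,\eta\in T_v(TM)),$$ and it has the following property. For every geodesic $\gamma\colon J\to M$ of $(M,g)$ on an open interval $J$ (a smooth curve with $\nabla_{\gamma'}\gamma'=0$), the tangent curve $\gamma'\colon J\to TM$ is a geodesic of $(TM,\overline g)$ of the same causal character: for every $t\in J$ the velocity of the curve $\gamma'$ at $t$ is spacelike, timelike or lightlike for $\overline g$ exactly if $\gamma'(t)$ is so for $g$. Here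 a tangent vector $w$ is timelike for a pseudo-Riemannian metric $h$ if $h(w,w)<0$, lightlike if $h(w,w)=0$ and $w\neq0$, and spacelike if $h(w,w)>0$ or $w=0$. -/

import Mathlib

open Bundle Manifold
open scoped ContDiff Topology

noncomputable section

section PseudoRiemannian

variable {E : Type*} [NormedAddCommGroup E] [NormedSpace ℝ E]
  {H : Type*} [TopologicalSpace H] {I : ModelWithCorners ℝ E H}
  {M : Type*} [TopologicalSpace M] [ChartedSpace H M] [IsManifold I ∞ M]

variable (I M) in
/-- A (smooth) pseudo-Riemannian metric on a connected smooth manifold `M` without boundary: a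
smooth field of nondegenerate symmetric bilinear forms on the tangent spaces (on a connected
manifold the index of such a field is automatically constant). -/
structure PseudoRiemannianMetric where
  /-- the bilinear form on each tangent space -/
  val (x : M) : TangentSpace I x →L[ℝ] TangentSpace I x →L[ℝ] ℝ
  symm (x : M) (v w : TangentSpace I x) : val x v w = val x w v
  nondegenerate (x : M) (v : TangentSpace I x) (hv : ∀ w : TangentSpace I x, val x v w = 0) : v = 0
  contMDiff : ContMDiff I (I.prod 𝓘(ℝ, E →L[ℝ] E →L[ℝ] ℝ)) ∞
    (fun x ↦ TotalSpace.mk' (E →L[ℝ] E →L[ℝ] ℝ)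
      (E := fun x : M ↦ TangentSpace I x →L[ℝ] TangentSpace I x →L[ℝ] ℝ) x (val x))

namespace PseudoRiemannianMetric

variable (g : PseudoRiemannianMetric I M)

/-- The metric in the coordinates given by the chart at `x₀`: the pull-back of `g` under the inverse
of the chart, a field of bilinear forms on (the chart domain in) the model vector space `E`. -/
def coord (x₀ : M) (y : E) : E →L[ℝ] E →L[ℝ] ℝ :=
  let B : E →L[ℝ] E →L[ℝ] ℝ := g.val ((extChartAt I x₀).symm y)
  let L : E →L[ℝ] E := mfderiv 𝓘(ℝ, E) I (extChartAt I x₀).symm y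
  B.bilinearComp L L

set_option synthInstance.maxHeartbeats 200000 in
/-- The Christoffel symbols of the first kind, `w ↦ ½ (D_u G (v, w) + D_v G (u, w) - D_w G (u, v))`,
at the coordinate point `y` in the chart at `x₀`, where `G` is the metric in coordinates. -/
def christoffelFirst (x₀ : M) (y u v : E) : E →L[ℝ] ℝ :=
  let D : E →L[ℝ] E →L[ℝ] E →L[ℝ] ℝ := fderiv ℝ (g.coord x₀) y
  (1 / 2 : ℝ) • (D u v + D v u - (D.flip u).flip v)

/-- The Christoffel symbols of the Levi-Civita connection of `g` in the chart at `x₀`: the vector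
`Γ(u, v)` with `G (Γ(u, v), w) = ½ (D_u G (v, w) + D_v G (u, w) - D_w G (u, v))` for all `w`.
In coordinates the connection is `∇_u X = D X(u) + Γ(u, X)`. (The metric in coordinates, seen as a
map from `E` to its dual, is invertible at points of the chart's target when `E` has finite
dimension.) -/
def christoffel (x₀ : M) (y u v : E) : E :=
  (g.coord x₀ y).inverse (g.christoffelFirst x₀ y u v)

/-- The coordinate expression, in the chart at `x₀`, of the covariant derivative `∇_{γ'} γ'` at time
`t` of the velocity of a curve `γ`, namely `c'' + Γ(c', c')` for `c` the curve in coordinates. -/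
def accelerationInChart (γ : ℝ → M) (x₀ : M) (t : ℝ) : E :=
  let c : ℝ → E := fun s ↦ extChartAt I x₀ (γ s)
  deriv (deriv c) t + g.christoffel x₀ (c t) (deriv c t) (deriv c t)

/-- `γ` is a geodesic of `g` on the open interval `J`: it is smooth there and `∇_{γ'} γ' = 0`,
an equation that is read in the charts. -/
def IsGeodesicOn (γ : ℝ → M) (J : Set ℝ) : Prop :=
  ContMDiffOn 𝓘(ℝ, ℝ) I ∞ γ J ∧
    ∀ t ∈ J, ∀ x₀ : M, γ t ∈ (extChartAt I x₀).source → g.accelerationInChart γ x₀ t = 0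

/-- The connection map `K : T TM → TM` of the Levi-Civita connection at `v ∈ TM`. In the coordinates
`(x, v)` on `TM` induced by a chart of `M` it is `K (ẋ, v̇) = v̇ + Γ(v, ẋ)`; this does not depend on
the chart, and it is computed here in the chart at the base point of `v`. -/
def connectionMap (v : TangentBundle I M) (ξ : TangentSpace I.tangent v) :
    TangentSpace I v.proj :=
  let e := trivializationAt E (TangentSpace I) v.proj
  let xdot : E := e.continuousLinearMapAt ℝ v.proj
    (mfderiv I.tangent I (TotalSpace.proj : TangentBundle I M → M) v ξ)
  let vdot : E := mfderiv I.tangent 𝓘(ℝ, E) (fun w : TangentBundle I M ↦ (e w).2) v ξ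
  e.symmL ℝ v.proj
    (vdot + g.christoffel v.proj (extChartAt I v.proj v.proj) (e v).2 xdot)

/-- `gbar` is the Sasaki metric of `g`: for every `v ∈ TM` it makes `(dπ, K)` an isometry from
`T_v TM` to `(T_p M × T_p M, g ⊕ g)`, where `p` is the base point of `v`, `π : TM → M` is the
projection and `K` is the connection map. -/
def IsSasakiMetric (gbar : PseudoRiemannianMetric I.tangent (TangentBundle I M)) : Prop :=
  ∀ (v : TangentBundle I M) (ξ η : TangentSpace I.tangent v),
    gbar.val v ξ η =
      g.val v.proj (mfderiv I.tangent I (TotalSpace.proj : TangentBundle I M → M) v ξ)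
        (mfderiv I.tangent I (TotalSpace.proj : TangentBundle I M → M) v η) +
      g.val v.proj (g.connectionMap v ξ) (g.connectionMap v η)

end PseudoRiemannianMetric

variable (I) in
/-- The velocity `γ'(t)` of a curve in `M`. -/
def velocity (γ : ℝ → M) (t : ℝ) : TangentSpace I (γ t) :=
  mfderiv 𝓘(ℝ, ℝ) I γ t (1 : ℝ)

variable (I) in
/-- The tangent curve `t ↦ γ'(t)` of `γ`, as a curve in the tangent bundle. -/
def tangentCurve (γ : ℝ → M) (t : ℝ) : TangentBundle I M :=
  ⟨γ t, velocity I γ t⟩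

/-- The three causal characters. -/
inductive CausalCharacter where
  | spacelike
  | timelike
  | lightlike

open Classical in
/-- The causal character of a tangent vector `v`: timelike if `g(v, v) < 0`, lightlike if
`g(v, v) = 0` and `v ≠ 0`, spacelike if `g(v, v) > 0` or `v = 0`. -/
def PseudoRiemannianMetric.causalCharacter (g : PseudoRiemannianMetric I M) {x : M}
    (v : TangentSpace I x) : CausalCharacter :=
  if g.val x v v < 0 then .timelike
  else if g.val x v v = 0 ∧ v ≠ 0 then .lightlike
  else .spacelike

end PseudoRiemannian

end

/-! The geodesic equation is used as the Euler–Lagrange equation of the energy, so the Christoffel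
symbols of the Sasaki metric never have to be computed. In coordinates, let `G` be the metric, `c` a
geodesic and `C = (c, c')` its tangent curve. Applying the connection map to `C'` gives `c'' + Γ(c',
c')`, so the geodesic equation says precisely that `C'` is horizontal. Hence the momentum of `C` in
a direction `w` is `G(c', w.1)`. Moreover, the vertical part of the Sasaki form is quadratic in the
connection map, so its derivative in the base point vanishes on the horizontal vector `C'`. Both
sides of the Euler–Lagrange equation of `C` thus reduce to those of `c`, tested on `w.1`. This is
`sasakiForm_geodesic`, based on `geodesic_equation_iff` and
`fderiv_sasakiForm_of_connectionForm_eq_zero`. Horizontality also gives the causal character: the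
vertical term of the squared length of `C'` is zero.

For the existence of the metric, the coordinate expression `sasakiForm` is nondegenerate because
`(dπ, K)` is bijective, and smooth because inversion of operators is. By
`christoffelVector_transformation` the connection map commutes with coordinate changes, so the
expressions in the charts glue (`sasakiForm_tangentLift`, `sasakiForm_chart_eq`). -/

noncomputable section

set_option synthInstance.maxHeartbeats 400000

/-! ### Christoffel symbols of a field of bilinear forms on a vector space -/

section BilinearFields

variable {E : Type*} [NormedAddCommGroup E] [NormedSpace ℝ E]
  {F : Type*} [NormedAddCommGroup F] [NormedSpace ℝ F]

/-- Shortcut instances for the spaces of bilinear and trilinear forms. -/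
instance bilinNormedAddCommGroup : NormedAddCommGroup (E →L[ℝ] E →L[ℝ] ℝ) :=
  ContinuousLinearMap.toNormedAddCommGroup

instance bilinNormedSpace : NormedSpace ℝ (E →L[ℝ] E →L[ℝ] ℝ) :=
  ContinuousLinearMap.toNormedSpace

instance trilinNormedAddCommGroup : NormedAddCommGroup (E →L[ℝ] E →L[ℝ] E →L[ℝ] ℝ) :=
  ContinuousLinearMap.toNormedAddCommGroup

instance trilinNormedSpace : NormedSpace ℝ (E →L[ℝ] E →L[ℝ] E →L[ℝ] ℝ) :=
  ContinuousLinearMap.toNormedSpace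

/-- The Christoffel symbols of the first kind of a field `G` of bilinear forms on a normed space. -/
def christoffelForm (G : E → E →L[ℝ] E →L[ℝ] ℝ) (y u v : E) : E →L[ℝ] ℝ :=
  let D : E →L[ℝ] E →L[ℝ] E →L[ℝ] ℝ := fderiv ℝ G y
  (1 / 2 : ℝ) • (D u v + D v u - (D.flip u).flip v)

/-- The Christoffel symbols of a field `G` of bilinear forms on a normed space. -/
def christoffelVector (G : E → E →L[ℝ] E →L[ℝ] ℝ) (y u v : E) : E :=
  (G y).inverse (christoffelForm G y u v)

/-- A bilinear form is nondegenerate on the left. -/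
def BilinNondegenerate (B : E →L[ℝ] E →L[ℝ] ℝ) : Prop :=
  ∀ v, (∀ w, B v w = 0) → v = 0

lemma christoffelForm_apply (G : E → E →L[ℝ] E →L[ℝ] ℝ) (y u v w : E) :
    christoffelForm G y u v w =
      1 / 2 * (fderiv ℝ G y u v w + fderiv ℝ G y v u w - fderiv ℝ G y w u v) := by
  simp [christoffelForm]

lemma christoffelForm_add_right (G : E → E →L[ℝ] E →L[ℝ] ℝ) (y u v v' : E) :
    christoffelForm G y u (v + v') = christoffelForm G y u v + christoffelForm G y u v' := by
  ext w
  simp only [christoffelForm_apply, map_add, _root_.add_apply]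
  ring

lemma christoffelForm_smul_right (G : E → E →L[ℝ] E →L[ℝ] ℝ) (y u v : E) (a : ℝ) :
    christoffelForm G y u (a • v) = a • christoffelForm G y u v := by
  ext w
  simp only [christoffelForm_apply, map_smul, _root_.smul_apply, smul_eq_mul]
  ring

lemma christoffelVector_add_right (G : E → E →L[ℝ] E →L[ℝ] ℝ) (y u v v' : E) :
    christoffelVector G y u (v + v') = christoffelVector G y u v + christoffelVector G y u v' := by
  simp only [christoffelVector, christoffelForm_add_right, map_add]

lemma christoffelVector_smul_right (G : E → E →L[ℝ] E →L[ℝ] ℝ) (y u v : E) (a : ℝ) :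
    christoffelVector G y u (a • v) = a • christoffelVector G y u v := by
  simp only [christoffelVector, christoffelForm_smul_right, map_smul]

/-- The Christoffel symbols `Γ(u, ·)` as a continuous linear map. -/
def christoffelCLM [FiniteDimensional ℝ E] (G : E → E →L[ℝ] E →L[ℝ] ℝ) (y u : E) : E →L[ℝ] E :=
  LinearMap.toContinuousLinearMap
    { toFun := christoffelVector G y u
      map_add' := christoffelVector_add_right G y u
      map_smul' := fun a v ↦ christoffelVector_smul_right G y u v a }

@[simp]
lemma christoffelCLM_apply [FiniteDimensional ℝ E] (G : E → E →L[ℝ] E →L[ℝ] ℝ) (y u v : E) :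
    christoffelCLM G y u v = christoffelVector G y u v := rfl

/-- An injective map from `E` to its dual is bijective by equality of dimensions. This ensures that
`inverse` in `christoffelVector` is a true inverse and not its default value zero. -/
lemma BilinNondegenerate.isInvertible [FiniteDimensional ℝ E] {B : E →L[ℝ] E →L[ℝ] ℝ}
    (hB : BilinNondegenerate B) : B.IsInvertible := by
  have hinj : Function.Injective (B : E →ₗ[ℝ] (E →L[ℝ] ℝ)) := by
    rw [injective_iff_map_eq_zero]
    intro v hv
    refine hB v fun w ↦ ?_
    have : B v = 0 := hv
    simp [this]
  have hdim : Module.finrank ℝ E = Module.finrank ℝ (E →L[ℝ] ℝ) := by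
    have e : (E →ₗ[ℝ] ℝ) ≃ₗ[ℝ] (E →L[ℝ] ℝ) := LinearMap.toContinuousLinearMap
    rw [← e.finrank_eq]
    exact (Subspace.dual_finrank_eq).symm
  exact ⟨(LinearEquiv.ofInjectiveOfFinrankEq (B : E →ₗ[ℝ] (E →L[ℝ] ℝ)) hinj
    hdim).toContinuousLinearEquiv, by ext; rfl⟩

lemma BilinNondegenerate.apply_christoffelVector [FiniteDimensional ℝ E]
    {G : E → E →L[ℝ] E →L[ℝ] ℝ} {y : E} (hG : BilinNondegenerate (G y)) (u v w : E) :
    G y (christoffelVector G y u v) w = christoffelForm G y u v w := by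
  rw [christoffelVector, hG.isInvertible.self_apply_inverse]

lemma christoffelForm_congr {G G' : E → E →L[ℝ] E →L[ℝ] ℝ} {y : E} (h : G =ᶠ[𝓝 y] G') (u v : E) :
    christoffelForm G y u v = christoffelForm G' y u v := by
  simp only [christoffelForm, h.fderiv_eq]

lemma christoffelVector_congr {G G' : E → E →L[ℝ] E →L[ℝ] ℝ} {y : E} (h : G =ᶠ[𝓝 y] G')
    (u v : E) : christoffelVector G y u v = christoffelVector G' y u v := by
  simp only [christoffelVector, christoffelForm_congr h, h.eq_of_nhds]

/-- The derivative of `s ↦ B(s)(p(s), q(s))`. -/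
lemma HasFDerivAt.bilin_apply {B : F → E →L[ℝ] E →L[ℝ] ℝ} {p q : F → E}
    {B' : F →L[ℝ] E →L[ℝ] E →L[ℝ] ℝ} {p' q' : F →L[ℝ] E} {z : F}
    (hB : HasFDerivAt B B' z) (hp : HasFDerivAt p p' z) (hq : HasFDerivAt q q' z) :
    ∃ L : F →L[ℝ] ℝ, HasFDerivAt (fun s ↦ B s (p s) (q s)) L z ∧
      ∀ u, L u = B' u (p z) (q z) + B z (p' u) (q z) + B z (p z) (q' u) := by
  refine ⟨_, (hB.clm_apply hp).clm_apply hq, fun u ↦ ?_⟩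
  simp
  ring

lemma fderiv_bilin_apply {B : E → E →L[ℝ] E →L[ℝ] ℝ} {z : E} (hB : DifferentiableAt ℝ B z)
    (u v w : E) : fderiv ℝ B z u v w = fderiv ℝ (fun s ↦ B s v w) z u := by
  obtain ⟨L, hL, h⟩ := hB.hasFDerivAt.bilin_apply (hasFDerivAt_const v z) (hasFDerivAt_const w z)
  rw [hL.fderiv, h]
  simp

/-- The transformation law of the Christoffel symbols under a change of coordinates. -/
lemma christoffelVector_transformation [FiniteDimensional ℝ E] {G G' : E → E →L[ℝ] E →L[ℝ] ℝ}
    {φ : E → E} {y : E} (hφ : ContDiffAt ℝ 2 φ y)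
    (hG : DifferentiableAt ℝ G y) (hG' : DifferentiableAt ℝ G' (φ y))
    (hpull : ∀ᶠ z in 𝓝 y, ∀ v w, G z v w = G' (φ z) (fderiv ℝ φ z v) (fderiv ℝ φ z w))
    (hsymm : ∀ v w, G' (φ y) v w = G' (φ y) w v)
    (hGn : BilinNondegenerate (G y)) (hGn' : BilinNondegenerate (G' (φ y)))
    (hsurj : Function.Surjective (fderiv ℝ φ y)) (u v : E) :
    fderiv ℝ φ y (christoffelVector G y u v) =
      christoffelVector G' (φ y) (fderiv ℝ φ y u) (fderiv ℝ φ y v) +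
        fderiv ℝ (fderiv ℝ φ) y u v := by
  have hφd : HasFDerivAt φ (fderiv ℝ φ y) y := (hφ.differentiableAt (by norm_num)).hasFDerivAt
  have hφ2 : HasFDerivAt (fderiv ℝ φ) (fderiv ℝ (fderiv ℝ φ) y) y :=
    ((hφ.fderiv_right (m := 1) (by norm_num)).differentiableAt (by norm_num)).hasFDerivAt
  have hsec : ∀ a b, fderiv ℝ (fderiv ℝ φ) y a b = fderiv ℝ (fderiv ℝ φ) y b a :=
    fun a b ↦ (hφ.isSymmSndFDerivAt (by simp)).eq a b
  -- Chain and product rule applied to the pull-back identity, which is why that identity is assumed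
  -- near `y` and not only at `y`.
  have key : ∀ a b c, fderiv ℝ G y a b c =
      fderiv ℝ G' (φ y) (fderiv ℝ φ y a) (fderiv ℝ φ y b) (fderiv ℝ φ y c) +
      G' (φ y) (fderiv ℝ (fderiv ℝ φ) y a b) (fderiv ℝ φ y c) +
      G' (φ y) (fderiv ℝ φ y b) (fderiv ℝ (fderiv ℝ φ) y a c) := by
    intro a b c
    rw [fderiv_bilin_apply hG]
    have h1 : (fun s ↦ G s b c) =ᶠ[𝓝 y] fun s ↦ G' (φ s) (fderiv ℝ φ s b) (fderiv ℝ φ s c) :=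
      hpull.mono fun s hs ↦ hs b c
    rw [h1.fderiv_eq]
    have hcomp : HasFDerivAt (fun s ↦ G' (φ s)) ((fderiv ℝ G' (φ y)).comp (fderiv ℝ φ y)) y :=
      HasFDerivAt.comp (g := G') y hG'.hasFDerivAt hφd
    obtain ⟨L, hL, h⟩ := hcomp.bilin_apply
      (hφ2.clm_apply (hasFDerivAt_const b y)) (hφ2.clm_apply (hasFDerivAt_const c y))
    rw [hL.fderiv, h]
    simp
  -- By nondegeneracy it suffices to pair the difference with every vector, and by surjectivity each
  -- of these is an image under the derivative of `φ`. The pairings are Christoffel forms, and in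
  -- their cyclic combination all second-derivative terms but one cancel by symmetry.
  rw [← sub_eq_zero]
  refine hGn' _ fun w' ↦ ?_
  obtain ⟨w, rfl⟩ := hsurj w'
  rw [map_sub, map_add, _root_.sub_apply, _root_.add_apply,
    hGn'.apply_christoffelVector, ← hpull.self_of_nhds, hGn.apply_christoffelVector,
    christoffelForm_apply, christoffelForm_apply, key, key, key, hsec v u, hsec w u, hsec w v,
    hsymm (fderiv ℝ φ y u) (fderiv ℝ (fderiv ℝ φ) y v w),
    hsymm (fderiv ℝ φ y v) (fderiv ℝ (fderiv ℝ φ) y u w)]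
  ring

end BilinearFields

/-! ### The Sasaki metric in coordinates -/

section SasakiForm

variable {E : Type*} [NormedAddCommGroup E] [NormedSpace ℝ E] [FiniteDimensional ℝ E]

/-- The connection map in coordinates. -/
def connectionForm (G : E → E →L[ℝ] E →L[ℝ] ℝ) (z : E × E) : E × E →L[ℝ] E :=
  ContinuousLinearMap.snd ℝ E E +
    (christoffelCLM G z.1 z.2).comp (ContinuousLinearMap.fst ℝ E E)

lemma connectionForm_apply (G : E → E →L[ℝ] E →L[ℝ] ℝ) (z a : E × E) :
    connectionForm G z a = a.2 + christoffelVector G z.1 z.2 a.1 := by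
  simp [connectionForm]

/-- The Sasaki metric in coordinates. -/
def sasakiForm (G : E → E →L[ℝ] E →L[ℝ] ℝ) (z : E × E) : E × E →L[ℝ] E × E →L[ℝ] ℝ :=
  (G z.1).bilinearComp (ContinuousLinearMap.fst ℝ E E) (ContinuousLinearMap.fst ℝ E E) +
    (G z.1).bilinearComp (connectionForm G z) (connectionForm G z)

lemma sasakiForm_apply (G : E → E →L[ℝ] E →L[ℝ] ℝ) (z a b : E × E) :
    sasakiForm G z a b =
      G z.1 a.1 b.1 + G z.1 (connectionForm G z a) (connectionForm G z b) := by
  simp [sasakiForm]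

/-- The pair formed by the first component and the connection map is triangular, hence injective.
Pairing with vertical vectors `(0, w)`, on which the connection map is `w`, kills the vertical part;
the horizontal part is then isolated by `(w, 0)`. -/
lemma sasakiForm_nondegenerate {G : E → E →L[ℝ] E →L[ℝ] ℝ} {z : E × E}
    (hG : BilinNondegenerate (G z.1)) : BilinNondegenerate (sasakiForm G z) := by
  intro a ha
  have h2 : connectionForm G z a = 0 := by
    refine hG _ fun w ↦ ?_
    have := ha (0, w)
    rw [sasakiForm_apply, connectionForm_apply G z (0, w)] at this
    have h0 : christoffelVector G z.1 z.2 0 = 0 := by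
      rw [← christoffelCLM_apply, map_zero]
    simpa [h0] using this
  have h1 : a.1 = 0 := by
    refine hG _ fun w ↦ ?_
    have := ha (w, 0)
    rw [sasakiForm_apply, h2] at this
    simpa using this
  rw [connectionForm_apply, h1, ← christoffelCLM_apply, map_zero, add_zero] at h2
  exact Prod.ext h1 h2

omit [FiniteDimensional ℝ E] in
lemma contDiffOn_bilin_apply {F : Type*} [NormedAddCommGroup F] [NormedSpace ℝ F] {s : Set F}
    {B : F → E →L[ℝ] E →L[ℝ] ℝ} {p q : F → E} {n : ℕ∞ω} (hB : ContDiffOn ℝ n B s)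
    (hp : ContDiffOn ℝ n p s) (hq : ContDiffOn ℝ n q s) :
    ContDiffOn ℝ n (fun x ↦ B x (p x) (q x)) s :=
  (hB.clm_apply hp).clm_apply hq

variable {G : E → E →L[ℝ] E →L[ℝ] ℝ} {U : Set E}

/-- Inversion is smooth at invertible operators, and in finite dimension a family of linear forms is
smooth once its value at each fixed vector is. -/
lemma contDiffOn_christoffelVector (hU : IsOpen U) (hG : ContDiffOn ℝ ∞ G U)
    (hn : ∀ y ∈ U, BilinNondegenerate (G y)) (a : E) :
    ContDiffOn ℝ ∞ (fun z : E × E ↦ christoffelVector G z.1 z.2 a) (U ×ˢ Set.univ) := by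
  have hfst : ContDiffOn ℝ ∞ (fun z : E × E ↦ z.1) (U ×ˢ Set.univ) := contDiffOn_fst
  have hsnd : ContDiffOn ℝ ∞ (fun z : E × E ↦ z.2) (U ×ˢ Set.univ) := contDiffOn_snd
  have hmaps : Set.MapsTo (fun z : E × E ↦ z.1) (U ×ˢ Set.univ) U := fun z hz ↦ hz.1
  have hG1 : ContDiffOn ℝ ∞ (fun z : E × E ↦ G z.1) (U ×ˢ Set.univ) := hG.comp hfst hmaps
  have hD : ContDiffOn ℝ ∞ (fun z : E × E ↦ fderiv ℝ G z.1) (U ×ˢ Set.univ) :=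
    (hG.fderiv_of_isOpen hU (m := ∞) (by simp)).comp hfst hmaps
  have hinv : ContDiffOn ℝ ∞ (fun z : E × E ↦ (G z.1).inverse) (U ×ˢ Set.univ) := by
    intro z hz
    exact (ContinuousLinearMap.IsInvertible.contDiffAt_map_inverse
      (hn z.1 hz.1).isInvertible).comp_contDiffWithinAt z (hG1 z hz)
  refine hinv.clm_apply ?_
  rw [contDiffOn_clm_apply]
  intro w
  simp only [christoffelForm_apply]
  refine contDiffOn_const.mul ((ContDiffOn.add ?_ ?_).sub ?_)
  · exact contDiffOn_bilin_apply (hD.clm_apply hsnd) contDiffOn_const contDiffOn_const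
  · exact contDiffOn_bilin_apply (hD.clm_apply contDiffOn_const) hsnd contDiffOn_const
  · exact contDiffOn_bilin_apply (hD.clm_apply contDiffOn_const) hsnd contDiffOn_const

lemma contDiffOn_connectionForm (hU : IsOpen U) (hG : ContDiffOn ℝ ∞ G U)
    (hn : ∀ y ∈ U, BilinNondegenerate (G y)) (a : E × E) :
    ContDiffOn ℝ ∞ (fun z : E × E ↦ connectionForm G z a) (U ×ˢ Set.univ) := by
  simp only [connectionForm_apply]
  exact contDiffOn_const.add (contDiffOn_christoffelVector hU hG hn a.1)

lemma contDiffOn_sasakiForm (hU : IsOpen U) (hG : ContDiffOn ℝ ∞ G U)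
    (hn : ∀ y ∈ U, BilinNondegenerate (G y)) :
    ContDiffOn ℝ ∞ (sasakiForm G) (U ×ˢ Set.univ) := by
  rw [contDiffOn_clm_apply]
  intro a
  rw [contDiffOn_clm_apply]
  intro b
  simp only [sasakiForm_apply]
  have hG1 : ContDiffOn ℝ ∞ (fun z : E × E ↦ G z.1) (U ×ˢ Set.univ) :=
    hG.comp contDiffOn_fst fun z hz ↦ hz.1
  exact (contDiffOn_bilin_apply hG1 contDiffOn_const contDiffOn_const).add
    (contDiffOn_bilin_apply hG1 (contDiffOn_connectionForm hU hG hn a)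
      (contDiffOn_connectionForm hU hG hn b))

/-! ### The geodesic equation as an Euler–Lagrange equation -/

omit [FiniteDimensional ℝ E] in
/-- The derivative of the momentum along a curve. -/
lemma hasDerivAt_momentum {c : ℝ → E} {t : ℝ} {a : E}
    (hG : DifferentiableAt ℝ G (c t)) (hc : DifferentiableAt ℝ c t)
    (hc' : HasDerivAt (deriv c) a t) (w : E) :
    HasDerivAt (fun s ↦ G (c s) (deriv c s) w)
      (G (c t) a w + fderiv ℝ G (c t) (deriv c t) (deriv c t) w) t := by
  have h1 : HasDerivAt (fun s ↦ G (c s)) (fderiv ℝ G (c t) (deriv c t)) t :=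
    HasFDerivAt.comp_hasDerivAt (l := G) t hG.hasFDerivAt hc.hasDerivAt
  have h2 := (h1.clm_apply hc').clm_apply (hasDerivAt_const t w)
  simp only [map_zero, add_zero, add_apply] at h2
  rwa [add_comm] at h2

/-- The geodesic equation as the Euler–Lagrange equation of the energy. -/
lemma geodesic_equation_iff {c : ℝ → E} {t : ℝ}
    (hG : DifferentiableAt ℝ G (c t)) (hn : BilinNondegenerate (G (c t)))
    (hc : DifferentiableAt ℝ c t) (hc' : DifferentiableAt ℝ (deriv c) t) :
    deriv (deriv c) t + christoffelVector G (c t) (deriv c t) (deriv c t) = 0 ↔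
      ∀ w, deriv (fun s ↦ G (c s) (deriv c s) w) t =
        1 / 2 * fderiv ℝ G (c t) w (deriv c t) (deriv c t) := by
  -- With both arguments equal to `c'`, the first two terms of the Christoffel form coincide and
  -- cancel the factor `1 / 2`; together with `G(c'', w)` they make up the derivative of the
  -- momentum.
  have key : ∀ w, G (c t) (deriv (deriv c) t +
      christoffelVector G (c t) (deriv c t) (deriv c t)) w =
      deriv (fun s ↦ G (c s) (deriv c s) w) t -
        1 / 2 * fderiv ℝ G (c t) w (deriv c t) (deriv c t) := by
    intro w
    rw [(hasDerivAt_momentum hG hc hc'.hasDerivAt w).deriv, map_add, add_apply,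
      hn.apply_christoffelVector, christoffelForm_apply]
    ring
  constructor
  · intro h w
    have := key w
    rw [h] at this
    simp only [map_zero, zero_apply] at this
    linarith
  · intro h
    refine hn _ fun w ↦ ?_
    rw [key, h, sub_self]

/-- Where the connection map vanishes on `a`, the derivative of `sasakiForm G z a a` in `z` only
sees the horizontal part. -/
lemma fderiv_sasakiForm_of_connectionForm_eq_zero (hU : IsOpen U) (hG : ContDiffOn ℝ ∞ G U)
    (hn : ∀ y ∈ U, BilinNondegenerate (G y)) {z : E × E} (hz : z.1 ∈ U) {a : E × E}
    (ha : connectionForm G z a = 0) (w : E × E) :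
    fderiv ℝ (sasakiForm G) z w a a = fderiv ℝ G z.1 w.1 a.1 a.1 := by
  have hopen : IsOpen (U ×ˢ (Set.univ : Set E)) := hU.prod isOpen_univ
  have hnhds : U ×ˢ (Set.univ : Set E) ∈ 𝓝 z := hopen.mem_nhds ⟨hz, trivial⟩
  have hS : DifferentiableAt ℝ (sasakiForm G) z :=
    ((contDiffOn_sasakiForm hU hG hn).contDiffAt hnhds).differentiableAt (by simp)
  have hκ : DifferentiableAt ℝ (fun z ↦ connectionForm G z a) z :=
    ((contDiffOn_connectionForm hU hG hn a).contDiffAt hnhds).differentiableAt (by simp)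
  have hG0 : HasFDerivAt G (fderiv ℝ G z.1) z.1 :=
    ((hG.contDiffAt (hU.mem_nhds hz)).differentiableAt (by simp)).hasFDerivAt
  have hG1 : HasFDerivAt (fun z : E × E ↦ G z.1)
      ((fderiv ℝ G z.1).comp (ContinuousLinearMap.fst ℝ E E)) z :=
    HasFDerivAt.comp (g := G) z hG0 hasFDerivAt_fst
  obtain ⟨L₁, hL₁, h₁⟩ := hG1.bilin_apply (hasFDerivAt_const a.1 z) (hasFDerivAt_const a.1 z)
  obtain ⟨L₂, hL₂, h₂⟩ := hG1.bilin_apply hκ.hasFDerivAt hκ.hasFDerivAt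
  rw [fderiv_bilin_apply hS]
  simp only [sasakiForm_apply]
  rw [(hL₁.fun_add hL₂).fderiv, add_apply, h₁, h₂]
  -- Every term of the derivative of `G(κ a, κ a)`, with `κ` the connection map, keeps an
  -- undifferentiated factor `κ a = 0`.
  simp [ha]

/-- The lift of a geodesic to the tangent bundle is a geodesic of the Sasaki metric. -/
lemma sasakiForm_geodesic (hU : IsOpen U) (hG : ContDiffOn ℝ ∞ G U)
    (hn : ∀ y ∈ U, BilinNondegenerate (G y)) {c : ℝ → E} {t : ℝ} (hc : ContDiffAt ℝ ∞ c t)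
    (hct : c t ∈ U)
    (hgeo : ∀ᶠ s in 𝓝 t,
      deriv (deriv c) s + christoffelVector G (c s) (deriv c s) (deriv c s) = 0)
    {C : ℝ → E × E} (hC : C =ᶠ[𝓝 t] fun s ↦ (c s, deriv c s)) :
    deriv (deriv C) t + christoffelVector (sasakiForm G) (C t) (deriv C t) (deriv C t) = 0 := by
  have hc1 : ContDiffAt ℝ ∞ (deriv c) t := hc.derivWithin (by simp)
  have hC0 : ContDiffAt ℝ ∞ C t := (hc.prodMk hc1).congr_of_eventuallyEq hC
  have hC1 : ContDiffAt ℝ ∞ (deriv C) t := hC0.derivWithin (by simp)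
  -- Regularity at a point spreads to a neighbourhood for orders other than `∞`, hence the passage
  -- to order 2.
  have hle : (2 : ℕ∞ω) ≤ ∞ := ENat.LEInfty.out
  have hev : ∀ᶠ s in 𝓝 t, DifferentiableAt ℝ c s :=
    ((hc.of_le hle).eventually (by simp)).mono fun s hs ↦ hs.differentiableAt (by norm_num)
  have hev1 : ∀ᶠ s in 𝓝 t, DifferentiableAt ℝ (deriv c) s :=
    ((hc1.of_le hle).eventually (by simp)).mono fun s hs ↦ hs.differentiableAt (by norm_num)
  have hCd : ∀ᶠ s in 𝓝 t, C s = (c s, deriv c s) ∧ deriv C s = (deriv c s, deriv (deriv c) s) := by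
    filter_upwards [hC.eventuallyEq_nhds, hev, hev1] with s hs h1 h2
    exact ⟨hs.eq_of_nhds, by rw [hs.deriv_eq, (h1.hasDerivAt.prodMk h2.hasDerivAt).deriv]⟩
  -- Horizontality of `C'` is the geodesic equation of `c`. It is needed near `t`, since the
  -- momentum of `C` is differentiated below.
  have hκ : ∀ᶠ s in 𝓝 t, connectionForm G (C s) (deriv C s) = 0 := by
    filter_upwards [hCd, hgeo] with s hs h
    rw [connectionForm_apply, hs.1, hs.2]
    exact h
  obtain ⟨hCt, hCt'⟩ := hCd.self_of_nhds
  have hzU : (C t).1 ∈ U := by rw [hCt]; exact hct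
  have hS : DifferentiableAt ℝ (sasakiForm G) (C t) :=
    ((contDiffOn_sasakiForm hU hG hn).contDiffAt
      ((hU.prod isOpen_univ).mem_nhds ⟨hzU, trivial⟩)).differentiableAt (by simp)
  rw [geodesic_equation_iff hS (sasakiForm_nondegenerate (hn _ hzU))
    (hC0.differentiableAt (by simp)) (hC1.differentiableAt (by simp))]
  intro w
  rw [fderiv_sasakiForm_of_connectionForm_eq_zero hU hG hn hzU hκ.self_of_nhds]
  have hEq : (fun s ↦ sasakiForm G (C s) (deriv C s) w) =ᶠ[𝓝 t]
      fun s ↦ G (c s) (deriv c s) w.1 := by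
    filter_upwards [hCd, hκ] with s hs h
    rw [sasakiForm_apply, h, map_zero, zero_apply, add_zero, hs.1, hs.2]
  rw [hEq.deriv_eq, hCt, hCt']
  exact (geodesic_equation_iff ((hG.contDiffAt (hU.mem_nhds hct)).differentiableAt (by simp))
    (hn _ hct) (hc.differentiableAt (by simp)) (hc1.differentiableAt (by simp))).1
    hgeo.self_of_nhds w.1

end SasakiForm

/-! ### Smoothness of fields of bilinear forms, read in charts -/

section FormsInCharts

variable {E : Type*} [NormedAddCommGroup E] [NormedSpace ℝ E]
  {H : Type*} [TopologicalSpace H] {I : ModelWithCorners ℝ E H}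
  {M : Type*} [TopologicalSpace M] [ChartedSpace H M]

/-- A field of bilinear forms on the tangent spaces, in the coordinates given by the chart at
`x₀`. -/
def coordForm (B : ∀ x : M, TangentSpace I x →L[ℝ] TangentSpace I x →L[ℝ] ℝ) (x₀ : M) (y : E) :
    E →L[ℝ] E →L[ℝ] ℝ :=
  let B' : E →L[ℝ] E →L[ℝ] ℝ := B ((extChartAt I x₀).symm y)
  let L : E →L[ℝ] E := mfderiv 𝓘(ℝ, E) I (extChartAt I x₀).symm y
  B'.bilinearComp L L

lemma coordForm_apply (B : ∀ x : M, TangentSpace I x →L[ℝ] TangentSpace I x →L[ℝ] ℝ) (x₀ : M)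
    (y v w : E) :
    coordForm B x₀ y v w = B ((extChartAt I x₀).symm y)
      (mfderiv 𝓘(ℝ, E) I (extChartAt I x₀).symm y v)
      (mfderiv 𝓘(ℝ, E) I (extChartAt I x₀).symm y w) := rfl

variable [IsManifold I ∞ M] [I.Boundaryless]

/-- Without boundary the model has full range, so the derivative within the range is the ordinary
one. This links the trivializations in the definition of smoothness to the derivatives in
`coordForm`. -/
lemma trivializationAt_symm_eq_mfderiv {x₀ x : M} (hx : x ∈ (chartAt H x₀).source) (v : E) :
    (trivializationAt E (TangentSpace I) x₀).symm x v =
      mfderiv 𝓘(ℝ, E) I (extChartAt I x₀).symm (extChartAt I x₀ x) v := by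
  have h := TangentBundle.symmL_trivializationAt (I := I) hx
  rw [I.range_eq_univ, mfderivWithin_univ] at h
  exact (Trivialization.symmL_apply (R := ℝ) _ (by exact hx) v).symm.trans (DFunLike.congr_fun h v)

omit [I.Boundaryless] in
lemma trivializationAt_snd_eq_mfderiv {x₀ : M} (w : TangentBundle I M)
    (hx : w.proj ∈ (chartAt H x₀).source) :
    (trivializationAt E (TangentSpace I) x₀ w).2 =
      mfderiv I 𝓘(ℝ, E) (extChartAt I x₀) w.proj w.2 := by
  have h := TangentBundle.continuousLinearMapAt_trivializationAt (I := I) hx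
  have h2 := DFunLike.congr_fun h w.2
  refine Eq.trans ?_ h2
  rw [Trivialization.continuousLinearMapAt_apply, Trivialization.linearMapAt_apply,
    if_pos (by exact hx)]

lemma coordForm_eq_inCoordinates
    (B : ∀ x : M, TangentSpace I x →L[ℝ] TangentSpace I x →L[ℝ] ℝ) {x₀ x : M}
    (hx : x ∈ (chartAt H x₀).source) :
    (trivializationAt (E →L[ℝ] E →L[ℝ] ℝ)
      (fun x : M ↦ TangentSpace I x →L[ℝ] TangentSpace I x →L[ℝ] ℝ) x₀ ⟨x, B x⟩).2 =
      coordForm B x₀ (extChartAt I x₀ x) := by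
  rw [hom_trivializationAt_apply]
  ext v w
  rw [coordForm_apply]
  dsimp only
  rw [inCoordinates_apply_eq₂ (by exact hx) (by exact hx) (Set.mem_univ _),
    trivializationAt_symm_eq_mfderiv hx, trivializationAt_symm_eq_mfderiv hx,
    (extChartAt I x₀).left_inv (by rwa [extChartAt_source])]
  simp

/-- A field of bilinear forms is smooth if and only if it is smooth in charts. -/
lemma contMDiff_form_iff (B : ∀ x : M, TangentSpace I x →L[ℝ] TangentSpace I x →L[ℝ] ℝ) :
    ContMDiff I (I.prod 𝓘(ℝ, E →L[ℝ] E →L[ℝ] ℝ)) ∞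
      (fun x ↦ TotalSpace.mk' (E →L[ℝ] E →L[ℝ] ℝ)
        (E := fun x : M ↦ TangentSpace I x →L[ℝ] TangentSpace I x →L[ℝ] ℝ) x (B x)) ↔
    ∀ x₀ : M, ContDiffOn ℝ ∞ (coordForm B x₀) (extChartAt I x₀).target := by
  have key : ∀ x₀ : M, ContMDiffOn I (I.prod 𝓘(ℝ, E →L[ℝ] E →L[ℝ] ℝ)) ∞
      (fun x ↦ TotalSpace.mk' (E →L[ℝ] E →L[ℝ] ℝ)
        (E := fun x : M ↦ TangentSpace I x →L[ℝ] TangentSpace I x →L[ℝ] ℝ) x (B x))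
      (chartAt H x₀).source ↔ ContMDiffOn I 𝓘(ℝ, E →L[ℝ] E →L[ℝ] ℝ) ∞
      (fun x ↦ coordForm B x₀ (extChartAt I x₀ x)) (chartAt H x₀).source := by
    intro x₀
    rw [(trivializationAt (E →L[ℝ] E →L[ℝ] ℝ)
      (fun x : M ↦ TangentSpace I x →L[ℝ] TangentSpace I x →L[ℝ] ℝ)
      x₀).contMDiffOn_section_iff (chartAt H x₀).open_source (fun x hx ↦ ⟨hx, hx, trivial⟩)]
    exact contMDiffOn_congr fun x hx ↦ coordForm_eq_inCoordinates B hx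
  constructor
  · intro h x₀
    have h1 := ((key x₀).1 h.contMDiffOn).comp (contMDiffOn_extChartAt_symm (n := ∞) x₀)
      (fun y hy ↦ by
        have := (extChartAt I x₀).map_target hy
        rwa [extChartAt_source] at this)
    rw [contMDiffOn_iff_contDiffOn] at h1
    refine h1.congr fun y hy ↦ ?_
    simp only [Function.comp_apply]
    rw [(extChartAt I x₀).right_inv hy]
  · intro h x₀
    have h1 : ContMDiffOn I 𝓘(ℝ, E →L[ℝ] E →L[ℝ] ℝ) ∞
        (fun x ↦ coordForm B x₀ (extChartAt I x₀ x)) (chartAt H x₀).source := by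
      have := (h x₀).contMDiffOn.comp (contMDiffOn_extChartAt (I := I) (n := ∞) (x := x₀))
        (fun x hx ↦ (extChartAt I x₀).map_source (by rwa [extChartAt_source]))
      exact this
    exact ((key x₀).2 h1).contMDiffAt
      ((chartAt H x₀).open_source.mem_nhds (mem_chart_source H x₀))

end FormsInCharts

/-! ### Invariance of the Sasaki form under coordinate changes -/

section SasakiTransformation

variable {E : Type*} [NormedAddCommGroup E] [NormedSpace ℝ E] [FiniteDimensional ℝ E]

/-- The map induced on tangent vectors by a map between vector spaces. -/
def tangentLift (φ : E → E) (z : E × E) : E × E := (φ z.1, fderiv ℝ φ z.1 z.2)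

omit [FiniteDimensional ℝ E] in
lemma hasFDerivAt_tangentLift {φ : E → E} {z : E × E} (hφ : ContDiffAt ℝ 2 φ z.1) :
    ∃ L : E × E →L[ℝ] E × E, HasFDerivAt (tangentLift φ) L z ∧ ∀ a, L a =
      (fderiv ℝ φ z.1 a.1, fderiv ℝ (fderiv ℝ φ) z.1 a.1 z.2 + fderiv ℝ φ z.1 a.2) := by
  have h1 : HasFDerivAt φ (fderiv ℝ φ z.1) z.1 :=
    (hφ.differentiableAt (by norm_num)).hasFDerivAt
  have h2 : HasFDerivAt (fderiv ℝ φ) (fderiv ℝ (fderiv ℝ φ) z.1) z.1 :=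
    ((hφ.fderiv_right (m := 1) (by norm_num)).differentiableAt (by norm_num)).hasFDerivAt
  have h3 : HasFDerivAt (fun z : E × E ↦ fderiv ℝ φ z.1)
      ((fderiv ℝ (fderiv ℝ φ) z.1).comp (ContinuousLinearMap.fst ℝ E E)) z :=
    HasFDerivAt.comp (g := fderiv ℝ φ) z h2 hasFDerivAt_fst
  have h4 : HasFDerivAt (fun z : E × E ↦ φ z.1)
      ((fderiv ℝ φ z.1).comp (ContinuousLinearMap.fst ℝ E E)) z :=
    HasFDerivAt.comp (g := φ) z h1 hasFDerivAt_fst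
  refine ⟨_, h4.prodMk (h3.clm_apply hasFDerivAt_snd), fun a ↦ ?_⟩
  simp [add_comm]

/-- The Sasaki metric in coordinates does not depend on the coordinates. -/
lemma sasakiForm_tangentLift {G G' : E → E →L[ℝ] E →L[ℝ] ℝ}
    {φ : E → E} {z : E × E} (hφ : ContDiffAt ℝ 2 φ z.1)
    (hG : DifferentiableAt ℝ G z.1) (hG' : DifferentiableAt ℝ G' (φ z.1))
    (hpull : ∀ᶠ y in 𝓝 z.1, ∀ v w, G y v w = G' (φ y) (fderiv ℝ φ y v) (fderiv ℝ φ y w))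
    (hsymm : ∀ v w, G' (φ z.1) v w = G' (φ z.1) w v)
    (hGn : BilinNondegenerate (G z.1)) (hGn' : BilinNondegenerate (G' (φ z.1)))
    (hsurj : Function.Surjective (fderiv ℝ φ z.1)) (a b : E × E) :
    sasakiForm G' (tangentLift φ z) (fderiv ℝ (tangentLift φ) z a)
      (fderiv ℝ (tangentLift φ) z b) = sasakiForm G z a b := by
  obtain ⟨L, hL, hLa⟩ := hasFDerivAt_tangentLift hφ
  have hsec : ∀ a b, fderiv ℝ (fderiv ℝ φ) z.1 a b = fderiv ℝ (fderiv ℝ φ) z.1 b a :=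
    fun a b ↦ (hφ.isSymmSndFDerivAt (by simp)).eq a b
  -- The second derivative of `φ` in the tangent lift is the inhomogeneous term in the
  -- transformation law of the Christoffel symbols.
  have hconn : ∀ a, connectionForm G' (tangentLift φ z) (L a) =
      fderiv ℝ φ z.1 (connectionForm G z a) := by
    intro a
    rw [connectionForm_apply, connectionForm_apply, map_add,
      christoffelVector_transformation hφ hG hG' hpull hsymm hGn hGn' hsurj, hLa, hsec a.1]
    simp only [tangentLift]
    abel
  rw [hL.fderiv, sasakiForm_apply, sasakiForm_apply, hconn, hconn, hLa, hLa,
    hpull.self_of_nhds, hpull.self_of_nhds]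
  rfl

end SasakiTransformation

/-! ### Chart derivatives, chart changes and the metric in coordinates -/

section ChartsOfForms

variable {E : Type*} [NormedAddCommGroup E] [NormedSpace ℝ E]
  {H : Type*} [TopologicalSpace H] {I : ModelWithCorners ℝ E H} [I.Boundaryless]
  {M : Type*} [TopologicalSpace M] [ChartedSpace H M] [IsManifold I ∞ M]

/-- The derivative of the chart at `x₀`. -/
def chartDeriv (x₀ x : M) : TangentSpace I x →L[ℝ] E :=
  mfderiv I 𝓘(ℝ, E) (extChartAt I x₀) x

/-- The derivative of the inverse of the chart at `x₀`. -/
def chartSymmDeriv (I : ModelWithCorners ℝ E H) {M : Type*} [TopologicalSpace M] [ChartedSpace H M]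
    (x₀ : M) (y : E) : E →L[ℝ] TangentSpace I ((extChartAt I x₀).symm y) :=
  mfderiv 𝓘(ℝ, E) I (extChartAt I x₀).symm y

omit [I.Boundaryless] [IsManifold I ∞ M] in
lemma coordForm_eq_chartSymmDeriv
    (B : ∀ x : M, TangentSpace I x →L[ℝ] TangentSpace I x →L[ℝ] ℝ) (x₀ : M) (y v w : E) :
    coordForm B x₀ y v w = B ((extChartAt I x₀).symm y)
      (chartSymmDeriv I x₀ y v) (chartSymmDeriv I x₀ y w) := rfl

lemma chartDeriv_chartSymmDeriv {x₀ : M} {y : E} (hy : y ∈ (extChartAt I x₀).target) (v : E) :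
    chartDeriv x₀ ((extChartAt I x₀).symm y) (chartSymmDeriv I x₀ y v) = v := by
  have h := mfderiv_extChartAt_comp_mfderivWithin_extChartAt_symm (I := I) hy
  rw [I.range_eq_univ, mfderivWithin_univ] at h
  exact DFunLike.congr_fun h v

lemma chartSymmDeriv_chartDeriv {x₀ : M} {y : E} (hy : y ∈ (extChartAt I x₀).target)
    (v : TangentSpace I ((extChartAt I x₀).symm y)) :
    chartSymmDeriv I x₀ y (chartDeriv x₀ ((extChartAt I x₀).symm y) v) = v := by
  have h := mfderivWithin_extChartAt_symm_comp_mfderiv_extChartAt (I := I) hy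
  rw [I.range_eq_univ, mfderivWithin_univ] at h
  exact DFunLike.congr_fun h v

lemma chartDeriv_bijective {x₀ x : M} (hx : x ∈ (extChartAt I x₀).source) :
    Function.Bijective (chartDeriv (I := I) x₀ x) := by
  obtain ⟨y, hy, rfl⟩ : ∃ y ∈ (extChartAt I x₀).target, (extChartAt I x₀).symm y = x :=
    ⟨_, (extChartAt I x₀).map_source hx, (extChartAt I x₀).left_inv hx⟩
  exact Function.bijective_iff_has_inverse.2
    ⟨chartSymmDeriv I x₀ y, chartSymmDeriv_chartDeriv hy, chartDeriv_chartSymmDeriv hy⟩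

lemma coordForm_chartDeriv (B : ∀ x : M, TangentSpace I x →L[ℝ] TangentSpace I x →L[ℝ] ℝ)
    {x₀ x : M} (hx : x ∈ (extChartAt I x₀).source) (v w : TangentSpace I x) :
    coordForm B x₀ (extChartAt I x₀ x) (chartDeriv x₀ x v) (chartDeriv x₀ x w) = B x v w := by
  obtain ⟨y, hy, rfl⟩ : ∃ y ∈ (extChartAt I x₀).target, (extChartAt I x₀).symm y = x :=
    ⟨_, (extChartAt I x₀).map_source hx, (extChartAt I x₀).left_inv hx⟩
  rw [(extChartAt I x₀).right_inv hy, coordForm_eq_chartSymmDeriv,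
    chartSymmDeriv_chartDeriv hy, chartSymmDeriv_chartDeriv hy]

/-- The change of coordinates between the charts at `x₀` and `x₁`. -/
def chartChange (I : ModelWithCorners ℝ E H) (x₀ x₁ : M) : E → E :=
  extChartAt I x₁ ∘ (extChartAt I x₀).symm

lemma contDiffAt_chartChange {x₀ x₁ : M} {y : E} (hy : y ∈ (extChartAt I x₀).target)
    (hy₁ : (extChartAt I x₀).symm y ∈ (extChartAt I x₁).source) :
    ContDiffAt ℝ ∞ (chartChange I x₀ x₁) y := by
  have := contDiffWithinAt_ext_coord_change (I := I) (n := ∞) x₁ x₀ (y := y)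
    (by rw [PartialEquiv.trans_source]; exact ⟨hy, hy₁⟩)
  rwa [I.range_eq_univ, contDiffWithinAt_univ] at this

lemma fderiv_chartChange {x₀ x₁ : M} {y : E} (hy : y ∈ (extChartAt I x₀).target)
    (hy₁ : (extChartAt I x₀).symm y ∈ (extChartAt I x₁).source) (v : E) :
    fderiv ℝ (chartChange I x₀ x₁) y v =
      chartDeriv x₁ ((extChartAt I x₀).symm y) (chartSymmDeriv I x₀ y v) := by
  have h1 : MDifferentiableAt 𝓘(ℝ, E) I (extChartAt I x₀).symm y := by
    have := mdifferentiableWithinAt_extChartAt_symm (I := I) hy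
    rwa [I.range_eq_univ, mdifferentiableWithinAt_univ] at this
  have h2 : MDifferentiableAt I 𝓘(ℝ, E) (extChartAt I x₁) ((extChartAt I x₀).symm y) :=
    mdifferentiableAt_extChartAt (by rwa [extChartAt_source] at hy₁)
  rw [← mfderiv_eq_fderiv, chartChange, mfderiv_comp y h2 h1]
  rfl

lemma fderiv_chartChange_chartDeriv {x₀ x₁ : M} {x : M} (hx : x ∈ (extChartAt I x₀).source)
    (hx₁ : x ∈ (extChartAt I x₁).source) (v : TangentSpace I x) :
    fderiv ℝ (chartChange I x₀ x₁) (extChartAt I x₀ x) (chartDeriv x₀ x v) = chartDeriv x₁ x v := by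
  obtain ⟨y, hy, rfl⟩ : ∃ y ∈ (extChartAt I x₀).target, (extChartAt I x₀).symm y = x :=
    ⟨_, (extChartAt I x₀).map_source hx, (extChartAt I x₀).left_inv hx⟩
  rw [(extChartAt I x₀).right_inv hy, fderiv_chartChange hy hx₁, chartSymmDeriv_chartDeriv hy]

lemma coordForm_chartChange (B : ∀ x : M, TangentSpace I x →L[ℝ] TangentSpace I x →L[ℝ] ℝ)
    {x₀ x₁ : M} {y : E} (hy : y ∈ (extChartAt I x₀).target)
    (hy₁ : (extChartAt I x₀).symm y ∈ (extChartAt I x₁).source) (v w : E) :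
    coordForm B x₀ y v w = coordForm B x₁ (chartChange I x₀ x₁ y)
      (fderiv ℝ (chartChange I x₀ x₁) y v) (fderiv ℝ (chartChange I x₀ x₁) y w) := by
  rw [fderiv_chartChange hy hy₁, fderiv_chartChange hy hy₁, coordForm_eq_chartSymmDeriv B x₀]
  exact (coordForm_chartDeriv B hy₁ _ _).symm

lemma fderiv_chartChange_surjective {x₀ x₁ : M} {y : E} (hy : y ∈ (extChartAt I x₀).target)
    (hy₁ : (extChartAt I x₀).symm y ∈ (extChartAt I x₁).source) :
    Function.Surjective (fderiv ℝ (chartChange I x₀ x₁) y) := by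
  intro w
  obtain ⟨u, hu⟩ := (chartDeriv_bijective hy₁).2 w
  refine ⟨chartDeriv x₀ ((extChartAt I x₀).symm y) u, ?_⟩
  rw [fderiv_chartChange hy hy₁, chartSymmDeriv_chartDeriv hy, hu]

omit [IsManifold I ∞ M] in
lemma eventually_mem_chart_domains {x₀ x₁ : M} {y : E} (hy : y ∈ (extChartAt I x₀).target)
    (hy₁ : (extChartAt I x₀).symm y ∈ (extChartAt I x₁).source) :
    ∀ᶠ z in 𝓝 y, z ∈ (extChartAt I x₀).target ∧
      (extChartAt I x₀).symm z ∈ (extChartAt I x₁).source :=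
  ((isOpen_extChartAt_target x₀).eventually_mem hy).and
    ((continuousAt_extChartAt_symm'' hy).eventually_mem
      ((isOpen_extChartAt_source x₁).mem_nhds hy₁))

namespace PseudoRiemannianMetric

variable (g : PseudoRiemannianMetric I M)

omit [I.Boundaryless] in
lemma coord_eq_coordForm (x₀ : M) : g.coord x₀ = coordForm g.val x₀ := rfl

omit [I.Boundaryless] in
lemma christoffel_eq_christoffelVector (x₀ : M) (y u v : E) :
    g.christoffel x₀ y u v = christoffelVector (g.coord x₀) y u v := rfl

omit [I.Boundaryless] in
lemma coord_symm (x₀ : M) (y v w : E) : g.coord x₀ y v w = g.coord x₀ y w v := by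
  rw [coord_eq_coordForm, coordForm_eq_chartSymmDeriv, coordForm_eq_chartSymmDeriv, g.symm]

lemma contDiffOn_coord (x₀ : M) : ContDiffOn ℝ ∞ (g.coord x₀) (extChartAt I x₀).target :=
  (contMDiff_form_iff g.val).1 g.contMDiff x₀

lemma coord_nondegenerate {x₀ : M} {y : E} (hy : y ∈ (extChartAt I x₀).target) :
    BilinNondegenerate (g.coord x₀ y) := by
  intro v hv
  have h0 : chartSymmDeriv I x₀ y v = 0 := by
    refine g.nondegenerate _ _ fun w ↦ ?_
    rw [← chartSymmDeriv_chartDeriv hy w]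
    exact hv _
  rw [← chartDeriv_chartSymmDeriv hy v, h0, map_zero]

end PseudoRiemannianMetric

end ChartsOfForms

/-! ### Charts of the tangent bundle -/

section TangentCharts

variable {E : Type*} [NormedAddCommGroup E] [NormedSpace ℝ E]
  {H : Type*} [TopologicalSpace H] {I : ModelWithCorners ℝ E H}
  {M : Type*} [TopologicalSpace M] [ChartedSpace H M] [IsManifold I ∞ M]

lemma mem_tangentChart_source {v w : TangentBundle I M} :
    w ∈ (extChartAt I.tangent v).source ↔ w.proj ∈ (extChartAt I v.proj).source := by
  rw [extChartAt_source, extChartAt_source, TangentBundle.mem_chart_source_iff]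

lemma tangentChart_apply (v w : TangentBundle I M) :
    extChartAt I.tangent v w =
      (extChartAt I v.proj w.proj, (trivializationAt E (TangentSpace I) v.proj w).2) := rfl

lemma tangentChart_eq_chartDeriv {v w : TangentBundle I M}
    (hw : w.proj ∈ (extChartAt I v.proj).source) :
    extChartAt I.tangent v w =
      (extChartAt I v.proj w.proj, chartDeriv v.proj w.proj w.2) := by
  rw [tangentChart_apply, trivializationAt_snd_eq_mfderiv w (by rwa [extChartAt_source] at hw)]
  rfl

lemma mem_tangentChart_target {v : TangentBundle I M} {z : E × E} :
    z ∈ (extChartAt I.tangent v).target ↔ z.1 ∈ (extChartAt I v.proj).target := by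
  have h : (extChartAt I.tangent v).target = _ :=
    FiberBundle.extChartAt_target (IB := I) (F := E) (E := (TangentSpace I : M → Type _)) v
  rw [h]
  refine ⟨fun h ↦ h.1.1, fun h ↦ ⟨⟨h, ?_⟩, trivial⟩⟩
  have := (extChartAt I v.proj).map_target h
  rwa [extChartAt_source] at this

variable [I.Boundaryless]

/-- The chart of the tangent bundle is the derivative of the chart below, so the chain rule applies
wherever both charts are defined. Equality near the point allows derivatives to be compared as well.
-/
lemma chartChange_tangent_eventuallyEq {v₀ v₁ w : TangentBundle I M}
    (h₀ : w ∈ (extChartAt I.tangent v₀).source) (h₁ : w ∈ (extChartAt I.tangent v₁).source) :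
    chartChange I.tangent v₀ v₁ =ᶠ[𝓝 (extChartAt I.tangent v₀ w)]
      tangentLift (chartChange I v₀.proj v₁.proj) := by
  filter_upwards [eventually_mem_chart_domains ((extChartAt I.tangent v₀).map_source h₀)
    (by rwa [(extChartAt I.tangent v₀).left_inv h₀])] with z ⟨hz, hz₁⟩
  obtain ⟨w', hw', rfl⟩ : ∃ w' ∈ (extChartAt I.tangent v₀).source,
    extChartAt I.tangent v₀ w' = z :=
    ⟨_, (extChartAt I.tangent v₀).map_target hz, (extChartAt I.tangent v₀).right_inv hz⟩
  rw [(extChartAt I.tangent v₀).left_inv hw'] at hz₁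
  rw [chartChange, Function.comp_apply, (extChartAt I.tangent v₀).left_inv hw']
  rw [mem_tangentChart_source] at hw' hz₁
  rw [tangentChart_eq_chartDeriv hw', tangentChart_eq_chartDeriv hz₁, tangentLift,
    fderiv_chartChange_chartDeriv hw' hz₁, chartChange, Function.comp_apply,
    (extChartAt I v₀.proj).left_inv hw']

omit [I.Boundaryless] in
lemma mfderiv_comp_tangentChart {F : Type*} [NormedAddCommGroup F] [NormedSpace ℝ F]
    {v w : TangentBundle I M} (hw : w ∈ (extChartAt I.tangent v).source) (L : E × E →L[ℝ] F)
    (ξ : TangentSpace I.tangent w) :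
    mfderiv I.tangent 𝓘(ℝ, F) (fun w ↦ L (extChartAt I.tangent v w)) w ξ =
      L (chartDeriv v w ξ) := by
  have h1 : MDifferentiableAt I.tangent 𝓘(ℝ, E × E) (extChartAt I.tangent v) w :=
    mdifferentiableAt_extChartAt (by rwa [extChartAt_source] at hw)
  have h2 : HasMFDerivAt 𝓘(ℝ, E × E) 𝓘(ℝ, F) L (extChartAt I.tangent v w) L :=
    L.hasFDerivAt.hasMFDerivAt
  have h3 := (h2.comp w h1.hasMFDerivAt).mfderiv
  exact DFunLike.congr_fun h3 ξ

omit [I.Boundaryless] in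
/-- The first component of a tangent vector of the tangent bundle in coordinates is its
projection. -/
lemma chartDeriv_tangent_fst {v w : TangentBundle I M}
    (hw : w ∈ (extChartAt I.tangent v).source) (ξ : TangentSpace I.tangent w) :
    (chartDeriv v w ξ).1 = chartDeriv v.proj w.proj
      (mfderiv I.tangent I (TotalSpace.proj : TangentBundle I M → M) w ξ) := by
  have h := mfderiv_comp_tangentChart hw (ContinuousLinearMap.fst ℝ E E) ξ
  have h1 : MDifferentiableAt I 𝓘(ℝ, E) (extChartAt I v.proj) w.proj :=
    mdifferentiableAt_extChartAt (by
      rw [mem_tangentChart_source] at hw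
      rwa [extChartAt_source] at hw)
  have h2 : MDifferentiableAt I.tangent I (TotalSpace.proj : TangentBundle I M → M) w :=
    mdifferentiableAt_proj (E := (TangentSpace I : M → Type _))
  have h3 := DFunLike.congr_fun (mfderiv_comp w h1 h2) ξ
  exact h.symm.trans h3

omit [I.Boundaryless] in
lemma chartDeriv_tangent_snd {v w : TangentBundle I M}
    (hw : w ∈ (extChartAt I.tangent v).source) (ξ : TangentSpace I.tangent w) :
    (chartDeriv v w ξ).2 = mfderiv I.tangent 𝓘(ℝ, E)
      (fun w : TangentBundle I M ↦ (trivializationAt E (TangentSpace I) v.proj w).2) w ξ :=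
  (mfderiv_comp_tangentChart hw (ContinuousLinearMap.snd ℝ E E) ξ).symm

/-! ### The global Sasaki metric -/

namespace PseudoRiemannianMetric

variable [FiniteDimensional ℝ E] (g : PseudoRiemannianMetric I M)

/-- The Sasaki metric as a field of bilinear forms, defined in the chart at the base point. -/
def sasakiVal (w : TangentBundle I M) :
    TangentSpace I.tangent w →L[ℝ] TangentSpace I.tangent w →L[ℝ] ℝ :=
  let L : E × E →L[ℝ] E × E := chartDeriv (I := I.tangent) w w
  (sasakiForm (g.coord w.proj) (extChartAt I.tangent w w)).bilinearComp L L

omit [I.Boundaryless] in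
lemma sasakiVal_apply (w : TangentBundle I M) (ξ η : TangentSpace I.tangent w) :
    g.sasakiVal w ξ η = sasakiForm (g.coord w.proj) (extChartAt I.tangent w w)
      (chartDeriv w w ξ) (chartDeriv w w η) := rfl

lemma sasakiForm_chart_eq {v₀ v₁ w : TangentBundle I M}
    (h₀ : w ∈ (extChartAt I.tangent v₀).source) (h₁ : w ∈ (extChartAt I.tangent v₁).source)
    (ξ η : TangentSpace I.tangent w) :
    sasakiForm (g.coord v₁.proj) (extChartAt I.tangent v₁ w) (chartDeriv v₁ w ξ)
      (chartDeriv v₁ w η) =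
    sasakiForm (g.coord v₀.proj) (extChartAt I.tangent v₀ w) (chartDeriv v₀ w ξ)
      (chartDeriv v₀ w η) := by
  have hE := chartChange_tangent_eventuallyEq h₀ h₁
  have hp₀ := mem_tangentChart_source.1 h₀
  have hp₁ := mem_tangentChart_source.1 h₁
  have ht₀ : (extChartAt I.tangent v₀ w).1 ∈ (extChartAt I v₀.proj).target :=
    (extChartAt I v₀.proj).map_source hp₀
  have hs₁ : (extChartAt I v₀.proj).symm (extChartAt I.tangent v₀ w).1 ∈
      (extChartAt I v₁.proj).source := by
    rw [tangentChart_apply, (extChartAt I v₀.proj).left_inv hp₀]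
    exact hp₁
  have ht₁ : chartChange I v₀.proj v₁.proj (extChartAt I.tangent v₀ w).1 ∈
      (extChartAt I v₁.proj).target := (extChartAt I v₁.proj).map_source hs₁
  have hpt : extChartAt I.tangent v₁ w =
      tangentLift (chartChange I v₀.proj v₁.proj) (extChartAt I.tangent v₀ w) := by
    rw [← hE.eq_of_nhds, chartChange, Function.comp_apply,
      (extChartAt I.tangent v₀).left_inv h₀]
  rw [← fderiv_chartChange_chartDeriv h₀ h₁ ξ, ← fderiv_chartChange_chartDeriv h₀ h₁ η,
    hE.fderiv_eq, hpt]
  refine sasakiForm_tangentLift ((contDiffAt_chartChange ht₀ hs₁).of_le ENat.LEInfty.out)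
    (((g.contDiffOn_coord _).contDiffAt ((isOpen_extChartAt_target _).mem_nhds
      ht₀)).differentiableAt (by simp))
    (((g.contDiffOn_coord _).contDiffAt ((isOpen_extChartAt_target _).mem_nhds
      ht₁)).differentiableAt (by simp))
    ?_ (g.coord_symm _ _) (g.coord_nondegenerate ht₀) (g.coord_nondegenerate ht₁)
    (fderiv_chartChange_surjective ht₀ hs₁) _ _
  filter_upwards [eventually_mem_chart_domains ht₀ hs₁] with y hy a b
  exact coordForm_chartChange g.val hy.1 hy.2 a b

lemma sasakiVal_eq {v w : TangentBundle I M} (hw : w ∈ (extChartAt I.tangent v).source)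
    (ξ η : TangentSpace I.tangent w) :
    g.sasakiVal w ξ η = sasakiForm (g.coord v.proj) (extChartAt I.tangent v w)
      (chartDeriv v w ξ) (chartDeriv v w η) := by
  rw [sasakiVal_apply]
  exact g.sasakiForm_chart_eq hw (mem_extChartAt_source w) ξ η

/-- In `sasakiVal` the chart moves with the point, so smoothness is not visible from the definition.
Chart independence replaces it by one fixed chart, in which smoothness and Christoffel symbols can
be read off. -/
lemma coordForm_sasakiVal {v : TangentBundle I M} {z : E × E}
    (hz : z ∈ (extChartAt I.tangent v).target) :
    coordForm g.sasakiVal v z = sasakiForm (g.coord v.proj) z := by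
  refine ContinuousLinearMap.ext fun a ↦ ContinuousLinearMap.ext fun b ↦ ?_
  rw [coordForm_eq_chartSymmDeriv, g.sasakiVal_eq ((extChartAt I.tangent v).map_target hz),
    chartDeriv_chartSymmDeriv hz, chartDeriv_chartSymmDeriv hz,
    (extChartAt I.tangent v).right_inv hz]

/-- The Sasaki metric of `g`. -/
def sasaki : PseudoRiemannianMetric I.tangent (TangentBundle I M) where
  val := g.sasakiVal
  symm w ξ η := by
    rw [sasakiVal_apply, sasakiVal_apply, sasakiForm_apply, sasakiForm_apply, g.coord_symm,
      g.coord_symm _ _ (connectionForm _ _ _)]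
  nondegenerate w ξ hξ := by
    have hw := mem_extChartAt_source (I := I.tangent) w
    refine (chartDeriv_bijective hw).1 ?_
    rw [map_zero]
    refine sasakiForm_nondegenerate (G := g.coord w.proj) (z := extChartAt I.tangent w w)
      (g.coord_nondegenerate (mem_extChartAt_target w.proj)) _ fun a ↦ ?_
    obtain ⟨η, rfl⟩ := (chartDeriv_bijective hw).2 a
    exact hξ η
  contMDiff := by
    rw [contMDiff_form_iff]
    intro v
    have h := contDiffOn_sasakiForm (isOpen_extChartAt_target v.proj) (g.contDiffOn_coord v.proj)
      fun y hy ↦ g.coord_nondegenerate hy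
    refine (h.mono fun z hz ↦ ⟨mem_tangentChart_target.1 hz, trivial⟩).congr fun z hz ↦ ?_
    exact g.coordForm_sasakiVal hz

lemma sasaki_val (w : TangentBundle I M) : g.sasaki.val w = g.sasakiVal w := rfl

omit [I.Boundaryless] in
/-- The connection map in the chart at the base point. -/
lemma chartDeriv_connectionMap (w : TangentBundle I M) (ξ : TangentSpace I.tangent w) :
    chartDeriv w.proj w.proj (g.connectionMap w ξ) =
      connectionForm (g.coord w.proj) (extChartAt I.tangent w w) (chartDeriv w w ξ) := by
  have hw := mem_extChartAt_source (I := I.tangent) w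
  have hx : w.proj ∈ (chartAt H w.proj).source := mem_chart_source H w.proj
  have hT := TangentBundle.continuousLinearMapAt_trivializationAt (I := I) hx
  have hc : ∀ u : TangentSpace I w.proj, chartDeriv w.proj w.proj u =
      (trivializationAt E (TangentSpace I) w.proj).continuousLinearMapAt ℝ w.proj u :=
    fun u ↦ (DFunLike.congr_fun hT u).symm
  rw [hc, connectionMap, Trivialization.continuousLinearMapAt_symmL _ (by exact hx),
    connectionForm_apply, chartDeriv_tangent_fst hw, chartDeriv_tangent_snd hw, hc,
    christoffel_eq_christoffelVector]
  rfl

lemma isSasakiMetric_sasaki : g.IsSasakiMetric g.sasaki := by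
  intro w ξ η
  have hw := mem_extChartAt_source (I := I.tangent) w
  have hx := mem_extChartAt_source (I := I) w.proj
  rw [sasaki_val, sasakiVal_apply, sasakiForm_apply, ← chartDeriv_connectionMap,
    ← chartDeriv_connectionMap, chartDeriv_tangent_fst hw, chartDeriv_tangent_fst hw,
    ← coordForm_chartDeriv g.val hx, ← coordForm_chartDeriv g.val hx]
  rfl

end PseudoRiemannianMetric

end TangentCharts

/-! ### Tangent curves in charts -/

section Curves

variable {E : Type*} [NormedAddCommGroup E] [NormedSpace ℝ E]
  {H : Type*} [TopologicalSpace H] {I : ModelWithCorners ℝ E H}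
  {M : Type*} [TopologicalSpace M] [ChartedSpace H M] [IsManifold I ∞ M]
  {γ : ℝ → M} {t : ℝ}

lemma chartDeriv_velocity (hγ : MDifferentiableAt 𝓘(ℝ, ℝ) I γ t) {x₀ : M}
    (hx : γ t ∈ (extChartAt I x₀).source) :
    chartDeriv x₀ (γ t) (velocity I γ t) = deriv (fun s ↦ extChartAt I x₀ (γ s)) t := by
  have h1 : MDifferentiableAt I 𝓘(ℝ, E) (extChartAt I x₀) (γ t) :=
    mdifferentiableAt_extChartAt (by rwa [extChartAt_source] at hx)
  have h2 := DFunLike.congr_fun (mfderiv_comp t h1 hγ) (1 : ℝ)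
  rw [mfderiv_eq_fderiv] at h2
  exact h2.symm

lemma contDiffAt_extChartAt_comp (hγ : ContMDiffAt 𝓘(ℝ, ℝ) I ∞ γ t) {x₀ : M}
    (hx : γ t ∈ (extChartAt I x₀).source) :
    ContDiffAt ℝ ∞ (fun s ↦ extChartAt I x₀ (γ s)) t := by
  rw [← contMDiffAt_iff_contDiffAt]
  have h : ContMDiffAt I 𝓘(ℝ, E) ∞ (extChartAt I x₀) (γ t) :=
    contMDiffAt_extChartAt' (by rwa [extChartAt_source] at hx)
  exact h.comp t hγ

/-- The tangent curve in coordinates. -/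
lemma tangentChart_tangentCurve {J : Set ℝ} (hJ : IsOpen J)
    (hγ : ContMDiffOn 𝓘(ℝ, ℝ) I ∞ γ J) (ht : t ∈ J) {v : TangentBundle I M}
    (hx : γ t ∈ (extChartAt I v.proj).source) :
    (fun s ↦ extChartAt I.tangent v (tangentCurve I γ s)) =ᶠ[𝓝 t] fun s ↦
      (extChartAt I v.proj (γ s), deriv (fun s ↦ extChartAt I v.proj (γ s)) s) := by
  have hc : ContinuousAt γ t := (hγ.contMDiffAt (hJ.mem_nhds ht)).continuousAt
  filter_upwards [hJ.mem_nhds ht,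
    hc.eventually_mem ((isOpen_extChartAt_source v.proj).mem_nhds hx)] with s hs hsx
  rw [tangentChart_eq_chartDeriv (by exact hsx),
    ← chartDeriv_velocity ((hγ.contMDiffAt (hJ.mem_nhds hs)).mdifferentiableAt (by simp)) hsx]
  rfl

lemma contMDiffOn_tangentCurve {J : Set ℝ} (hJ : IsOpen J)
    (hγ : ContMDiffOn 𝓘(ℝ, ℝ) I ∞ γ J) :
    ContMDiffOn 𝓘(ℝ, ℝ) I.tangent ∞ (tangentCurve I γ) J := by
  intro t ht
  refine ContMDiffAt.contMDiffWithinAt ?_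
  have hγt := hγ.contMDiffAt (hJ.mem_nhds ht)
  have hx : γ t ∈ (extChartAt I (γ t)).source := mem_extChartAt_source (γ t)
  have hc1 : ContDiffAt ℝ ∞ (deriv fun s ↦ extChartAt I (γ t) (γ s)) t :=
    (contDiffAt_extChartAt_comp hγt hx).derivWithin (by simp)
  have hE := tangentChart_tangentCurve hJ hγ ht (v := tangentCurve I γ t) hx
  refine contMDiffAt_totalSpace.2 ⟨hγt, hc1.contMDiffAt.congr_of_eventuallyEq ?_⟩
  exact hE.mono fun s hs ↦ congrArg Prod.snd hs

/-! ### Geodesics and their causal character -/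

namespace PseudoRiemannianMetric

variable [FiniteDimensional ℝ E] [I.Boundaryless] {g : PseudoRiemannianMetric I M}

omit [FiniteDimensional ℝ E] [I.Boundaryless] in
/-- The geodesic equation of `g` in the chart at `x₀`, around a time of the geodesic. -/
lemma IsGeodesicOn.eventually_geodesic_equation {J : Set ℝ}
    (hg : g.IsGeodesicOn γ J) (hJ : IsOpen J) (ht : t ∈ J) {x₀ : M}
    (hx : γ t ∈ (extChartAt I x₀).source) :
    ∀ᶠ s in 𝓝 t, deriv (deriv fun s ↦ extChartAt I x₀ (γ s)) s +
      christoffelVector (g.coord x₀) (extChartAt I x₀ (γ s))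
        (deriv (fun s ↦ extChartAt I x₀ (γ s)) s)
        (deriv (fun s ↦ extChartAt I x₀ (γ s)) s) = 0 := by
  have hc : ContinuousAt γ t := (hg.1.contMDiffAt (hJ.mem_nhds ht)).continuousAt
  filter_upwards [hJ.mem_nhds ht,
    hc.eventually_mem ((isOpen_extChartAt_source x₀).mem_nhds hx)] with s hs hsx
  exact hg.2 s hs x₀ hsx

lemma IsGeodesicOn.isGeodesicOn_tangentCurve {J : Set ℝ}
    (hg : g.IsGeodesicOn γ J) (hJ : IsOpen J) :
    g.sasaki.IsGeodesicOn (tangentCurve I γ) J := by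
  refine ⟨contMDiffOn_tangentCurve hJ hg.1, fun t ht v hv ↦ ?_⟩
  have hx : γ t ∈ (extChartAt I v.proj).source := mem_tangentChart_source.1 hv
  have h := sasakiForm_geodesic (isOpen_extChartAt_target v.proj) (g.contDiffOn_coord v.proj)
    (fun y hy ↦ g.coord_nondegenerate hy)
    (contDiffAt_extChartAt_comp (hg.1.contMDiffAt (hJ.mem_nhds ht)) hx)
    ((extChartAt I v.proj).map_source hx) (hg.eventually_geodesic_equation hJ ht hx)
    (tangentChart_tangentCurve hJ hg.1 ht hx)
  -- Christoffel symbols contain a first derivative of the metric, so agreement on a neighbourhood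
  -- is required.
  have hcoord : g.sasaki.coord v =ᶠ[𝓝 (extChartAt I.tangent v (tangentCurve I γ t))]
      sasakiForm (g.coord v.proj) := by
    filter_upwards [(isOpen_extChartAt_target v).mem_nhds
      ((extChartAt I.tangent v).map_source hv)] with z hz
    exact g.coordForm_sasakiVal hz
  rw [accelerationInChart, christoffel_eq_christoffelVector, christoffelVector_congr hcoord]
  exact h

omit [I.Boundaryless] in
-- The velocity of the tangent curve is the horizontal lift of the velocity of the geodesic,
-- expressed in the chart at the point itself.
lemma IsGeodesicOn.chartDeriv_velocity_tangentCurve {J : Set ℝ}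
    (hg : g.IsGeodesicOn γ J) (hJ : IsOpen J) (ht : t ∈ J) :
    (chartDeriv (tangentCurve I γ t) (tangentCurve I γ t)
      (velocity I.tangent (tangentCurve I γ) t)).1 =
        chartDeriv (γ t) (γ t) (velocity I γ t) ∧
    connectionForm (g.coord (γ t))
      (extChartAt I.tangent (tangentCurve I γ t) (tangentCurve I γ t))
      (chartDeriv (tangentCurve I γ t) (tangentCurve I γ t)
        (velocity I.tangent (tangentCurve I γ) t)) = 0 := by
  have hγt := hg.1.contMDiffAt (hJ.mem_nhds ht)
  have hx : γ t ∈ (extChartAt I (γ t)).source := mem_extChartAt_source (γ t)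
  have hc := contDiffAt_extChartAt_comp hγt hx
  have hc1 : ContDiffAt ℝ ∞ (deriv fun s ↦ extChartAt I (γ t) (γ s)) t :=
    hc.derivWithin (by simp)
  have hE : (fun s ↦ extChartAt I.tangent (tangentCurve I γ t) (tangentCurve I γ s)) =ᶠ[𝓝 t]
      fun s ↦ (extChartAt I (γ t) (γ s), deriv (fun s ↦ extChartAt I (γ t) (γ s)) s) :=
    tangentChart_tangentCurve (v := tangentCurve I γ t) hJ hg.1 ht hx
  rw [chartDeriv_velocity (((contMDiffOn_tangentCurve hJ hg.1).contMDiffAt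
    (hJ.mem_nhds ht)).mdifferentiableAt (by simp)) (mem_extChartAt_source _),
    chartDeriv_velocity (hγt.mdifferentiableAt (by simp)) hx, hE.deriv_eq, hE.eq_of_nhds,
    ((hc.differentiableAt (by simp)).hasDerivAt.prodMk
      (hc1.differentiableAt (by simp)).hasDerivAt).deriv, connectionForm_apply]
  exact ⟨rfl, (hg.eventually_geodesic_equation hJ ht hx).self_of_nhds⟩

/-- A horizontal lift has the same squared length as its projection and vanishes with it: if the
first component is zero, the connection map returns the second component, which is then zero too.
The latter separates lightlike from zero vectors. -/
lemma IsGeodesicOn.causalCharacter_tangentCurve {J : Set ℝ}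
    (hg : g.IsGeodesicOn γ J) (hJ : IsOpen J) (ht : t ∈ J) :
    g.sasaki.causalCharacter (velocity I.tangent (tangentCurve I γ) t) =
      g.causalCharacter (velocity I γ t) := by
  obtain ⟨h1, h2⟩ := hg.chartDeriv_velocity_tangentCurve hJ ht
  have hx := mem_extChartAt_source (I := I) (γ t)
  have hval : g.sasaki.val _ (velocity I.tangent (tangentCurve I γ) t)
      (velocity I.tangent (tangentCurve I γ) t) =
      g.val _ (velocity I γ t) (velocity I γ t) := by
    rw [sasaki_val, sasakiVal_apply, sasakiForm_apply, ← coordForm_chartDeriv g.val hx, ← h1]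
    change _ + g.coord (γ t) _ (connectionForm (g.coord (γ t)) _ _) _ = _
    rw [h2, map_zero, zero_apply, add_zero]
    rfl
  have hzero : velocity I.tangent (tangentCurve I γ) t = 0 ↔ velocity I γ t = 0 := by
    rw [← (chartDeriv_bijective
      (mem_extChartAt_source (I := I.tangent) (tangentCurve I γ t))).1.eq_iff,
      ← (chartDeriv_bijective hx).1.eq_iff, map_zero, map_zero, ← h1]
    refine ⟨fun h ↦ by rw [h]; rfl, fun h ↦ ?_⟩
    rw [connectionForm_apply, h, ← christoffelCLM_apply, map_zero, add_zero] at h2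
    exact Prod.ext h h2
  classical
  exact if_congr (by rw [hval]) rfl (if_congr (by rw [hval, ne_eq, hzero]) rfl rfl)

end PseudoRiemannianMetric

end Curves

end

theorem mainTheorem9 {E : Type*} [NormedAddCommGroup E] [NormedSpace ℝ E] [FiniteDimensional ℝ E]
    {M : Type*} [TopologicalSpace M] [ChartedSpace E M] [IsManifold 𝓘(ℝ, E) ∞ M] [ConnectedSpace M]
    (g : PseudoRiemannianMetric 𝓘(ℝ, E) M) :
    ∃ gbar : PseudoRiemannianMetric 𝓘(ℝ, E).tangent (TangentBundle 𝓘(ℝ, E) M),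
      g.IsSasakiMetric gbar ∧
      ∀ (γ : ℝ → M) (J : Set ℝ), IsOpen J → J.OrdConnected → g.IsGeodesicOn γ J →
        gbar.IsGeodesicOn (tangentCurve 𝓘(ℝ, E) γ) J ∧
        ∀ t ∈ J,
          gbar.causalCharacter (velocity 𝓘(ℝ, E).tangent (tangentCurve 𝓘(ℝ, E) γ) t) =
            g.causalCharacter (velocity 𝓘(ℝ, E) γ t) :=
  ⟨g.sasaki, g.isSasakiMetric_sasaki, fun _ _ hJ _ hg ↦
    ⟨hg.isGeodesicOn_tangentCurve hJ, fun _ ht ↦ hg.causalCharacter_tangentCurve hJ ht⟩⟩
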